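/- Let $n\ge 1$, let $\mathbb B_n=\{z\in\mathbb C^n : |z|<1\}$, where $|\cdot|$ is the Euclidean norm, and let $\sigma$ be the normalized surface measure on the unit sphere $\partial\mathbb B_n$. Let $H^2(\mathbb B_n)$ be the space of holomorphic functions $f:\mathbb B_n\to\mathbb C$ with $$\|f\|^2:=\sup_{0\le r<1}\int_{\partial\mathbb B_n}|f(r\zeta)|^2\,d\sigma(\zeta)<\infty .$$ Let $\varphi:\mathbb B_n\to\mathbb B_n$ be a map such that the composition operator $C_\varphi f=f\circ\varphi$ is a bounded operator from $H^2(\mathbb B_n)$ to itself. Then $$\|C_\varphi\|\ \ge\ (1-|\varphi(0)|^2)^{-n/2}.$$ Moreover, this improves the lower bound $\{2(1-|\varphi(0)|)\}^{-n/2}$ of Figura: $$(1-|\varphi(0)|^2)^{-n/2}\ >\ \{2(1-|\varphi(0)|)\}^{-n/2}.$$ -/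

import Mathlib

open MeasureTheory Metric
open scoped ENNReal

noncomputable section

namespace HardyBall

/-- Complex Euclidean space of dimension `n`, with the Hermitian norm. -/
abbrev Cn (n : ℕ) : Type := EuclideanSpace ℂ (Fin n)

/-- The open unit ball of complex Euclidean space. -/
abbrev Ball (n : ℕ) : Type := ball (0 : Cn n) 1

/-- The unit sphere of complex Euclidean space. -/
abbrev Sphere (n : ℕ) : Type := sphere (0 : Cn n) 1

/-- The rotation-invariant probability measure on the sphere: the surface measure that Lebesgue
measure induces, divided by its total mass. -/
def sphereMeasure (n : ℕ) : Measure (Sphere n) :=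
  ((volume : Measure (Cn n)).toSphere Set.univ)⁻¹ • (volume : Measure (Cn n)).toSphere

/-- The point `r • ζ` of the ball, for `0 ≤ r < 1` and `ζ` in the sphere. -/
def dilate {n : ℕ} (r : Set.Ico (0 : ℝ) 1) (ζ : Sphere n) : Ball n :=
  ⟨(r : ℝ) • (ζ : Cn n), by
    have hζ : ‖(ζ : Cn n)‖ = 1 := mem_sphere_zero_iff_norm.1 ζ.2
    rw [mem_ball_zero_iff, norm_smul, hζ, mul_one, Real.norm_of_nonneg r.2.1]
    exact r.2.2⟩

/-- A function on the open ball is holomorphic if it is complex differentiable there. -/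
def IsHolomorphic {n : ℕ} (f : Ball n → ℂ) : Prop :=
  ∃ F : Cn n → ℂ, DifferentiableOn ℂ F (ball 0 1) ∧ ∀ z : Ball n, F z = f z

/-- `sup_{0 ≤ r < 1} ∫ |f (r ζ)|² dσ(ζ)`, the square of the Hardy norm. -/
def energy {n : ℕ} (f : Ball n → ℂ) : ℝ≥0∞ :=
  ⨆ r : Set.Ico (0 : ℝ) 1, ∫⁻ ζ, ‖f (dilate r ζ)‖ₑ ^ 2 ∂(sphereMeasure n)

lemma IsHolomorphic.continuous {n : ℕ} {f : Ball n → ℂ} (hf : IsHolomorphic f) :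
    Continuous f := by
  obtain ⟨F, hF, h⟩ := hf
  have : f = (ball (0 : Cn n) 1).domRestrict F := funext fun z => (h z).symm
  rw [this]
  exact hF.continuousOn.domRestrict

lemma continuous_dilate {n : ℕ} (r : Set.Ico (0 : ℝ) 1) :
    Continuous (dilate r : Sphere n → Ball n) :=
  Continuous.subtype_mk (continuous_subtype_val.const_smul (r : ℝ)) _

lemma lintegral_sq_eq {α : Type*} [MeasurableSpace α] (μ : Measure α) (f : α → ℂ) :
    ∫⁻ x, ‖f x‖ₑ ^ 2 ∂μ = eLpNorm f 2 μ ^ 2 := by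
  rw [eLpNorm_eq_lintegral_rpow_enorm_toReal (by norm_num) (by norm_num), ← ENNReal.rpow_natCast,
    ← ENNReal.rpow_mul]
  norm_num

lemma eLpNorm_le_energy {n : ℕ} (f : Ball n → ℂ) (r : Set.Ico (0 : ℝ) 1) :
    eLpNorm (fun ζ => f (dilate r ζ)) 2 (sphereMeasure n) ≤ energy f ^ (1 / 2 : ℝ) := by
  rw [one_div, ENNReal.le_rpow_inv_iff (by norm_num)]
  have h := le_iSup (fun r : Set.Ico (0 : ℝ) 1 =>
    ∫⁻ ζ, ‖f (dilate r ζ)‖ₑ ^ 2 ∂(sphereMeasure n)) r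
  simp only [lintegral_sq_eq] at h
  simpa [energy, lintegral_sq_eq] using h

lemma energy_add_le {n : ℕ} {f g : Ball n → ℂ} (hf : IsHolomorphic f) (hg : IsHolomorphic g) :
    energy (f + g) ≤ (energy f ^ (1 / 2 : ℝ) + energy g ^ (1 / 2 : ℝ)) ^ 2 := by
  refine iSup_le fun r => ?_
  rw [lintegral_sq_eq]
  gcongr
  refine (eLpNorm_add_le (f := fun ζ => f (dilate r ζ)) (g := fun ζ => g (dilate r ζ))
    (hf.continuous.comp (continuous_dilate r)).aestronglyMeasurable
    (hg.continuous.comp (continuous_dilate r)).aestronglyMeasurable (by norm_num)).trans ?_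
  exact add_le_add (eLpNorm_le_energy f r) (eLpNorm_le_energy g r)

lemma energy_smul {n : ℕ} (c : ℂ) (f : Ball n → ℂ) :
    energy (c • f) = ‖c‖ₑ ^ 2 * energy f := by
  simp only [energy, ENNReal.mul_iSup]
  refine iSup_congr fun r => ?_
  simp only [Pi.smul_apply, smul_eq_mul, enorm_mul, mul_pow]
  exact lintegral_const_mul' _ _ (ENNReal.pow_ne_top enorm_ne_top)

lemma eq_zero_of_energy {n : ℕ} [NeZero n] {f : Ball n → ℂ} (hf : IsHolomorphic f)
    (h : energy f = 0) : f = 0 := by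
  have key : ∀ r ζ, f (dilate r ζ) = 0 := by
    intro r
    have hle : ∫⁻ ζ, ‖f (dilate r ζ)‖ₑ ^ 2 ∂(sphereMeasure n) = 0 :=
      ENNReal.iSup_eq_zero.1 h r
    have hc : Continuous fun ζ => f (dilate r ζ) := hf.continuous.comp (continuous_dilate r)
    rw [sphereMeasure, lintegral_smul_measure, smul_eq_mul, mul_eq_zero] at hle
    have hle' := hle.resolve_left (ENNReal.inv_ne_zero.2 (measure_ne_top _ _))
    rw [lintegral_eq_zero_iff (hc.enorm.measurable.pow_const 2)] at hle'
    have h0 : (fun ζ => f (dilate r ζ)) = fun _ => 0 := by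
      refine (Continuous.ae_eq_iff_eq (volume : Measure (Cn n)).toSphere hc continuous_const).1 ?_
      filter_upwards [hle'] with ζ hζ
      simpa using hζ
    exact fun ζ => congrFun h0 ζ
  funext z
  obtain ⟨ζ, hζ⟩ : ∃ ζ : Sphere n, (‖(z : Cn n)‖ : ℝ) • (ζ : Cn n) = z := by
    by_cases hz : (z : Cn n) = 0
    · obtain ⟨ζ, hζ⟩ := NormedSpace.sphere_nonempty (x := (0 : Cn n)) (r := 1) |>.2 zero_le_one
      exact ⟨⟨ζ, hζ⟩, by simp [hz]⟩
    · have hz' : ‖(z : Cn n)‖ ≠ 0 := norm_ne_zero_iff.2 hz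
      refine ⟨⟨(‖(z : Cn n)‖)⁻¹ • (z : Cn n), ?_⟩, ?_⟩
      · rw [mem_sphere_zero_iff_norm, norm_smul, norm_inv, norm_norm, inv_mul_cancel₀ hz']
      · rw [smul_smul, mul_inv_cancel₀ hz', one_smul]
  have hk := key ⟨‖(z : Cn n)‖, norm_nonneg _, mem_ball_zero_iff.1 z.2⟩ ζ
  have hd : dilate ⟨‖(z : Cn n)‖, norm_nonneg _, mem_ball_zero_iff.1 z.2⟩ ζ = z := Subtype.ext hζ
  rw [hd] at hk
  exact hk

/-- The holomorphic functions on the ball with `sup_{0 ≤ r < 1} ∫ |f (r ζ)|² dσ(ζ) < ∞`. -/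
def hardySubmodule (n : ℕ) : Submodule ℂ (Ball n → ℂ) where
  carrier := {f | IsHolomorphic f ∧ energy f < ∞}
  zero_mem' := by
    refine ⟨⟨0, differentiableOn_const 0, fun _ => rfl⟩, ?_⟩
    simp [energy]
  add_mem' := by
    rintro f g ⟨hf, hf'⟩ ⟨hg, hg'⟩
    refine ⟨?_, (energy_add_le hf hg).trans_lt ?_⟩
    · obtain ⟨F, hF, h⟩ := hf
      obtain ⟨G, hG, k⟩ := hg
      exact ⟨F + G, hF.add hG, fun z => by simp [h z, k z]⟩
    · refine ENNReal.pow_lt_top (ENNReal.add_lt_top.2 ⟨?_, ?_⟩)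
      · exact ENNReal.rpow_lt_top_of_nonneg (by norm_num) hf'.ne
      · exact ENNReal.rpow_lt_top_of_nonneg (by norm_num) hg'.ne
  smul_mem' := by
    rintro c f ⟨⟨F, hF, h⟩, hf'⟩
    refine ⟨⟨c • F, hF.const_smul c, fun z => by simp [h z]⟩, ?_⟩
    rw [energy_smul]
    exact ENNReal.mul_lt_top (ENNReal.pow_lt_top enorm_lt_top) hf'

/-- The Hardy space `H²` of the unit ball. -/
def H2 (n : ℕ) : Type := hardySubmodule n

instance (n : ℕ) : AddCommGroup (H2 n) := inferInstanceAs (AddCommGroup (hardySubmodule n))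

instance (n : ℕ) : Module ℂ (H2 n) := inferInstanceAs (Module ℂ (hardySubmodule n))

/-- Elements of the Hardy space are functions on the ball. -/
instance (n : ℕ) : CoeFun (H2 n) fun _ => Ball n → ℂ := ⟨fun f => f.1⟩

/-- The Hardy norm, `(sup_{0 ≤ r < 1} ∫ |f (r ζ)|² dσ(ζ))^(1/2)`. -/
instance (n : ℕ) : Norm (H2 n) := ⟨fun f => √(energy (f : Ball n → ℂ)).toReal⟩

lemma norm_def {n : ℕ} (f : H2 n) : ‖f‖ = √(energy (f : Ball n → ℂ)).toReal := rfl

lemma norm_eq {n : ℕ} (f : H2 n) : ‖f‖ = (energy (f : Ball n → ℂ) ^ (1 / 2 : ℝ)).toReal := by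
  rw [norm_def, Real.sqrt_eq_rpow, ENNReal.toReal_rpow]

lemma core (n : ℕ) [NeZero n] : NormedSpace.Core ℂ (H2 n) where
  norm_nonneg f := Real.sqrt_nonneg _
  norm_smul c f := by
    change √(energy (c • f.1)).toReal = ‖c‖ * √(energy f.1).toReal
    rw [energy_smul, ENNReal.toReal_mul, Real.sqrt_mul ENNReal.toReal_nonneg, ENNReal.toReal_pow,
      toReal_enorm, Real.sqrt_sq (norm_nonneg c)]
  norm_triangle f g := by
    have hf : energy f.1 ^ (1 / 2 : ℝ) ≠ ∞ :=
      (ENNReal.rpow_lt_top_of_nonneg (by norm_num) f.2.2.ne).ne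
    have hg : energy g.1 ^ (1 / 2 : ℝ) ≠ ∞ :=
      (ENNReal.rpow_lt_top_of_nonneg (by norm_num) g.2.2.ne).ne
    rw [norm_eq f, norm_eq g, ← ENNReal.toReal_add hf hg]
    change √(energy (f.1 + g.1)).toReal ≤ _
    refine Real.sqrt_le_iff.2 ⟨ENNReal.toReal_nonneg, ?_⟩
    rw [← ENNReal.toReal_pow]
    exact ENNReal.toReal_mono (ENNReal.pow_ne_top (ENNReal.add_ne_top.2 ⟨hf, hg⟩))
      (energy_add_le f.2.1 g.2.1)
  norm_eq_zero_iff f := by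
    refine ⟨fun h => ?_, fun h => ?_⟩
    · have h' := (Real.sqrt_eq_zero ENNReal.toReal_nonneg).1 h
      exact Subtype.ext (eq_zero_of_energy f.2.1
        (((ENNReal.toReal_eq_zero_iff _).1 h').resolve_right f.2.2.ne))
    · subst h
      change √(energy (0 : Ball n → ℂ)).toReal = 0
      simp [energy]

instance (n : ℕ) [NeZero n] : NormedAddCommGroup (H2 n) := NormedAddCommGroup.ofCore (core n)

instance (n : ℕ) [NeZero n] : NormedSpace ℂ (H2 n) := NormedSpace.ofCore (core n)

/-- The bounded operator `T` on the Hardy space is the composition operator `f ↦ f ∘ φ`. Thus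
`f ↦ f ∘ φ` is bounded on the Hardy space exactly if there is such a `T`. -/
def IsCompositionOperator {n : ℕ} [NeZero n] (φ : Ball n → Ball n) (T : H2 n →L[ℂ] H2 n) : Prop :=
  ∀ f : H2 n, (T f : Ball n → ℂ) = (f : Ball n → ℂ) ∘ φ

end HardyBall

end

open Set

noncomputable section

namespace HardyBall

/-! Test the operator on the Szegő kernel with pole `a = φ 0`. Its partial sums `S_N` are
polynomials, so they lie in `H2`, with `‖S_N‖² ≤ S_N(a) =: D_N` (`energy_szegoPartialSum_le`).
Evaluation at the centre is a contraction, so `D_N = (T S_N)(0) ≤ ‖T‖ √D_N`, that is, `D_N ≤ ‖T‖²`.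
As `N → ∞`, `D_N` tends to `(1 - ‖a‖²)⁻ⁿ`.

The norm of `S_N` rests on two facts about the sphere: distinct powers of `⟨z, a⟩` are orthogonal,
and their moments are explicit (`integral_norm_inner_pow`). Both come from Gaussian integrals over
the whole space. -/

/-! ### Gaussian integrals and moments on the sphere -/

/-- The Gaussian integral of a homogeneous function, in polar coordinates. -/
lemma integral_homogeneous_mul_gaussian {𝕜 : Type*} [RCLike 𝕜] {n : ℕ} [NeZero n] (d : ℕ)
    (h : Cn n → 𝕜) (hh : ∀ (z : Cn n) (r : ℝ), 0 < r → h (r • z) = (r : 𝕜) ^ d * h z) :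
    ∫ z, h z * (Real.exp (-‖z‖ ^ 2) : 𝕜) =
      (∫ ζ : Sphere n, h ζ ∂(volume : Measure (Cn n)).toSphere) *
        ((1 / 2 * Real.Gamma ((2 * n + d) / 2) : ℝ) : 𝕜) := by
  have hpolar : ∫ z, h z * (Real.exp (-‖z‖ ^ 2) : 𝕜) =
      ∫ p : Sphere n × Ioi (0 : ℝ), h p.1 * (((p.2 : ℝ) ^ d * Real.exp (-(p.2 : ℝ) ^ 2) : ℝ) : 𝕜)
        ∂(volume : Measure (Cn n)).toSphere.prod
          (.volumeIoiPow (Module.finrank ℝ (Cn n) - 1)) := by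
    have hsub : ∫ z, h z * (Real.exp (-‖z‖ ^ 2) : 𝕜) = ∫ z : ({(0 : Cn n)}ᶜ : Set (Cn n)),
        h z * (Real.exp (-‖(z : Cn n)‖ ^ 2) : 𝕜) ∂(volume.comap Subtype.val) := by
      rw [integral_subtype_comap (measurableSet_singleton _).compl
        fun z : Cn n => h z * (Real.exp (-‖z‖ ^ 2) : 𝕜), restrict_compl_singleton]
    have hmp := (volume : Measure (Cn n)).measurePreserving_homeomorphUnitSphereProd.integral_comp
      (Homeomorph.measurableEmbedding _) fun p : Sphere n × Ioi (0 : ℝ) =>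
        h p.1 * (((p.2 : ℝ) ^ d * Real.exp (-(p.2 : ℝ) ^ 2) : ℝ) : 𝕜)
    rw [hsub, ← hmp]
    refine integral_congr_ae (.of_forall fun z => ?_)
    have hz : 0 < ‖(z : Cn n)‖ := norm_pos_iff.2 z.2
    have h1 : (z : Cn n) = ‖(z : Cn n)‖ • (‖(z : Cn n)‖⁻¹ • (z : Cn n)) := by
      rw [smul_smul, mul_inv_cancel₀ hz.ne', one_smul]
    have h2 := hh (‖(z : Cn n)‖⁻¹ • (z : Cn n)) ‖(z : Cn n)‖ hz
    rw [← h1] at h2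
    simp only [homeomorphUnitSphereProd_apply_fst_coe, homeomorphUnitSphereProd_apply_snd_coe]
    rw [h2]
    push_cast
    ring
  have hdim : Module.finrank ℝ (Cn n) = 2 * n := by
    rw [← Module.finrank_mul_finrank ℝ ℂ (Cn n)]; simp
  have hn : 1 ≤ n := NeZero.one_le
  rw [hpolar, integral_prod_mul (μ := (volume : Measure (Cn n)).toSphere) (fun ζ : Sphere n => h ζ)
    (fun r : Ioi (0 : ℝ) => (((r : ℝ) ^ d * Real.exp (-(r : ℝ) ^ 2) : ℝ) : 𝕜)), integral_ofReal,
    hdim]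
  congr 2
  simp only [Measure.volumeIoiPow, ENNReal.ofReal]
  rw [integral_withDensity_eq_integral_smul
      (measurable_subtype_coe.pow_const _).real_toNNReal,
    integral_subtype_comap measurableSet_Ioi
      fun a : ℝ => Real.toNNReal (a ^ (2 * n - 1)) • (a ^ d * Real.exp (-a ^ 2))]
  have := integral_rpow_mul_exp_neg_rpow (p := 2) (q := ((2 * n - 1 + d : ℕ) : ℝ)) (by norm_num)
    (lt_of_lt_of_le (by norm_num) (Nat.cast_nonneg _))
  convert! this using 1
  · refine setIntegral_congr_fun measurableSet_Ioi fun x hx => ?_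
    rw [mem_Ioi] at hx
    rw [NNReal.smul_def, Real.coe_toNNReal _ (pow_nonneg hx.le _), Real.rpow_natCast, pow_add,
      smul_eq_mul, mul_assoc]
    norm_num
  · congr 3
    rw [Nat.cast_add, Nat.cast_sub (by omega)]
    push_cast
    ring

/-- A complex rotation preserves the volume. -/
lemma measurePreserving_isometry {n : ℕ} (U : Cn n ≃ₗᵢ[ℂ] Cn n) :
    MeasurePreserving U volume volume :=
  ({ U.toLinearEquiv.restrictScalars ℝ with norm_map' := U.norm_map } :
    Cn n ≃ₗᵢ[ℝ] Cn n).measurePreserving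

lemma integral_comp_isometry {n : ℕ} {𝕜 : Type*} [RCLike 𝕜] (U : Cn n ≃ₗᵢ[ℂ] Cn n) (f : Cn n → 𝕜) :
    ∫ z, f (U z) = ∫ z, f z :=
  (measurePreserving_isometry U).integral_comp U.toHomeomorph.measurableEmbedding f

open scoped ComplexConjugate in
/-- Powers of a linear functional are orthogonal on the sphere. -/
lemma integral_toSphere_inner_pow_mul_conj {n : ℕ} [NeZero n] (a : Cn n) {j k : ℕ} (hjk : j ≠ k) :
    ∫ ζ : Sphere n, inner ℂ a (ζ : Cn n) ^ j * conj (inner ℂ a (ζ : Cn n)) ^ k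
      ∂(volume : Measure (Cn n)).toSphere = 0 := by
  have hpolar := integral_homogeneous_mul_gaussian (n := n) (j + k)
    (fun z => inner ℂ a z ^ j * conj (inner ℂ a z) ^ k) (fun z r _ => by
      rw [← Complex.coe_smul, inner_smul_right]
      simp only [map_mul, Complex.conj_ofReal, RCLike.ofReal_eq_complex_ofReal]
      ring)
  set h : Cn n → ℂ := fun z => inner ℂ a z ^ j * conj (inner ℂ a z) ^ k with hh
  suffices h0 : ∫ z, h z * ((Real.exp (-‖z‖ ^ 2) : ℝ) : ℂ) = 0 by
    have hG : (0 : ℝ) < 1 / 2 * Real.Gamma ((2 * n + (j + k : ℕ)) / 2) := by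
      have hn : 0 < n := NeZero.pos n
      exact mul_pos (by norm_num) (Real.Gamma_pos_of_pos (by positivity))
    refine (mul_eq_zero.1 (hpolar.symm.trans h0)).resolve_right ?_
    exact Complex.ofReal_ne_zero.2 hG.ne'
  -- Multiplication by such a `u` preserves volume and the Gaussian but changes the sign of `h`, so
  -- the integral equals its own negative.
  obtain ⟨u, hu, hu'⟩ : ∃ u : ℂ, ‖u‖ = 1 ∧ u ^ j * conj u ^ k = -1 := by
    have hd : ((j : ℂ) - k) ≠ 0 := sub_ne_zero.2 (by exact_mod_cast hjk)
    set t : ℝ := Real.pi / ((j : ℝ) - k) with ht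
    refine ⟨Complex.exp (t * Complex.I), Complex.norm_exp_ofReal_mul_I _, ?_⟩
    rw [← Complex.exp_conj, ← Complex.exp_nat_mul, ← Complex.exp_nat_mul, ← Complex.exp_add,
      ← Complex.exp_pi_mul_I]
    congr 1
    rw [map_mul, Complex.conj_I, Complex.conj_ofReal, ht]
    push_cast
    field_simp
    ring
  have hu0 : u ≠ 0 := by rintro rfl; simp at hu
  let U : Cn n ≃ₗᵢ[ℂ] Cn n :=
    { LinearEquiv.smulOfNeZero ℂ (Cn n) u hu0 with
      norm_map' := fun z => by
        change ‖u • z‖ = ‖z‖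
        rw [norm_smul, hu, one_mul] }
  have hU := integral_comp_isometry U (fun z => h z * ((Real.exp (-‖z‖ ^ 2) : ℝ) : ℂ))
  have hneg : ∀ z, h (U z) * ((Real.exp (-‖U z‖ ^ 2) : ℝ) : ℂ) =
      -(h z * ((Real.exp (-‖z‖ ^ 2) : ℝ) : ℂ)) := by
    intro z
    have h1 : h (U z) = - h z := by
      change inner ℂ a (u • z) ^ j * conj (inner ℂ a (u • z)) ^ k = _
      rw [inner_smul_right, map_mul, mul_pow, mul_pow, hh]
      linear_combination (inner ℂ a z ^ j * conj (inner ℂ a z) ^ k) * hu'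
    rw [U.norm_map, h1, neg_mul]
  simp only [hneg, integral_neg] at hU
  linear_combination (-1 / 2 : ℂ) * hU

/-- Uniqueness of Haar measure. The value of `c` is immaterial: it cancels once the moments are
normalized. -/
lemma exists_volume_eq_smul_pi (n : ℕ) : ∃ c : ℝ, 0 < c ∧ ∀ f : Cn n → ℝ,
    ∫ z, f z = c * ∫ x : Fin n → ℂ, f (WithLp.toLp 2 x) := by
  let e : (Fin n → ℂ) ≃L[ℝ] Cn n := (PiLp.continuousLinearEquiv 2 ℝ fun _ : Fin n => ℂ).symm
  have := e.isAddHaarMeasure_map (volume : Measure (Fin n → ℂ))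
  have hc := Measure.isAddLeftInvariant_eq_smul (volume : Measure (Cn n))
    ((volume : Measure (Fin n → ℂ)).map e)
  refine ⟨_, NNReal.coe_pos.2 (Measure.addHaarScalarFactor_pos_of_isAddHaarMeasure
    (volume : Measure (Cn n)) ((volume : Measure (Fin n → ℂ)).map e)), fun f => ?_⟩
  conv_lhs => rw [hc]
  rw [integral_smul_nnreal_measure, NNReal.smul_def, smul_eq_mul]
  exact congrArg _ (e.toHomeomorph.measurableEmbedding.integral_map f)

/-- In an orthonormal basis whose first vector points along `a`, the integrand is a product of
functions of one complex variable. What matters is that `c` depends on neither `a` nor `k`. -/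
lemma integral_norm_inner_pow_mul_gaussian (n : ℕ) [NeZero n] : ∃ c : ℝ, 0 < c ∧
    ∀ (a : Cn n) (k : ℕ), ∫ z : Cn n, ‖inner ℂ a z‖ ^ (2 * k) * Real.exp (-‖z‖ ^ 2) =
      c * (‖a‖ ^ (2 * k) * k.factorial) := by
  obtain ⟨c, hc, hvol⟩ := exists_volume_eq_smul_pi n
  refine ⟨c * Real.pi ^ n, by positivity, fun a k => ?_⟩
  obtain ⟨b, hb⟩ : ∃ b : OrthonormalBasis (Fin n) ℂ (Cn n), a = (‖a‖ : ℂ) • b 0 := by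
    obtain ⟨v, hv, hav⟩ : ∃ v : Cn n, ‖v‖ = 1 ∧ a = (‖a‖ : ℂ) • v := by
      by_cases ha : a = 0
      · exact ⟨EuclideanSpace.single 0 1, by simp, by simp [ha]⟩
      · exact ⟨(‖a‖⁻¹ : ℂ) • a, by simp [norm_smul, ha], by simp [smul_smul, ha]⟩
    obtain ⟨b, hb⟩ := Orthonormal.exists_orthonormalBasis_extension_of_card_eq (𝕜 := ℂ)
      (E := Cn n) (ι := Fin n) (by simp) (v := fun _ => v) (s := {0})
      ⟨fun _ => hv, fun i j hij => (hij (Subsingleton.elim i j)).elim⟩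
    exact ⟨b, by rw [hb 0 rfl, ← hav]⟩
  have hU := integral_comp_isometry b.repr.symm
    (fun z => ‖inner ℂ a z‖ ^ (2 * k) * Real.exp (-‖z‖ ^ 2))
  have hmom : ∀ m : ℕ, ∫ w : ℂ, ‖w‖ ^ (2 * m) * Real.exp (-‖w‖ ^ 2) = Real.pi * m.factorial := by
    intro m
    have := Complex.integral_rpow_mul_exp_neg_rpow (p := 2) (q := ((2 * m : ℕ) : ℝ)) (by norm_num)
      (lt_of_lt_of_le (by norm_num) (Nat.cast_nonneg _))
    simp only [Real.rpow_natCast, Real.rpow_ofNat] at this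
    rw [this, ← Real.Gamma_nat_eq_factorial]
    push_cast
    rw [show ((2 * (m : ℝ) + 2) / 2) = m + 1 by ring]
    ring
  have hfac : ∀ x : Fin n → ℂ, ‖inner ℂ a (b.repr.symm (WithLp.toLp 2 x))‖ ^ (2 * k) *
      Real.exp (-‖b.repr.symm (WithLp.toLp 2 x)‖ ^ 2) =
      ‖a‖ ^ (2 * k) * ∏ i, ‖x i‖ ^ (2 * (if i = 0 then k else 0)) * Real.exp (-‖x i‖ ^ 2) := by
    intro x
    have h1 : inner ℂ a (b.repr.symm (WithLp.toLp 2 x)) = (‖a‖ : ℂ) * x 0 := by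
      conv_lhs => rw [hb]
      rw [inner_smul_left, ← b.repr_apply_apply]
      simp
    rw [h1, LinearIsometryEquiv.norm_map, EuclideanSpace.norm_sq_eq, Finset.prod_mul_distrib,
      ← Real.exp_sum, Finset.sum_neg_distrib, Finset.prod_eq_single (0 : Fin n)]
    · simp only [norm_mul, Complex.norm_real, norm_norm, mul_pow, if_true]
      ring
    · intro i _ hi
      simp [hi]
    · simp
  rw [← hU, hvol]
  simp only [hfac]
  rw [integral_const_mul, integral_fintype_prod_volume_eq_prod
    (fun i w => ‖w‖ ^ (2 * (if i = 0 then k else 0)) * Real.exp (-‖w‖ ^ 2))]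
  simp only [hmom]
  rw [Finset.prod_mul_distrib, Finset.prod_const, Finset.card_univ, Fintype.card_fin,
    Finset.prod_eq_single (0 : Fin n)]
  · simp only [if_true]
    ring
  · intro i _ hi
    simp [hi]
  · simp

lemma toSphere_univ_ne_zero (n : ℕ) [NeZero n] :
    (volume : Measure (Cn n)).toSphere univ ≠ 0 := by
  rw [Measure.measure_univ_ne_zero]
  exact Measure.toSphere_ne_zero _

instance (n : ℕ) [NeZero n] : IsProbabilityMeasure (sphereMeasure n) :=
  ⟨by rw [sphereMeasure, Measure.smul_apply, smul_eq_mul,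
    ENNReal.inv_mul_cancel (toSphere_univ_ne_zero n) (measure_ne_top _ _)]⟩

lemma integral_sphereMeasure {n : ℕ} {𝕜 : Type*} [RCLike 𝕜] (f : Sphere n → 𝕜) :
    ∫ ζ, f ζ ∂sphereMeasure n =
      (((volume : Measure (Cn n)).toSphere.real univ)⁻¹ : ℝ) •
        ∫ ζ, f ζ ∂(volume : Measure (Cn n)).toSphere := by
  rw [sphereMeasure, integral_smul_measure, ENNReal.toReal_inv, Measure.real]

/-- The moments of a linear functional on the sphere. -/
lemma integral_norm_inner_pow {n : ℕ} [NeZero n] (a : Cn n) (k : ℕ) :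
    ((k + (n - 1)).choose (n - 1) : ℝ) *
      ∫ ζ : Sphere n, ‖inner ℂ a (ζ : Cn n)‖ ^ (2 * k) ∂sphereMeasure n = ‖a‖ ^ (2 * k) := by
  obtain ⟨c, hc, hgauss⟩ := integral_norm_inner_pow_mul_gaussian n
  have hpolar : ∀ m : ℕ, c * (‖a‖ ^ (2 * m) * m.factorial) =
      (∫ ζ : Sphere n, ‖inner ℂ a (ζ : Cn n)‖ ^ (2 * m) ∂(volume : Measure (Cn n)).toSphere) *
        (1 / 2 * ((n - 1 + m).factorial : ℝ)) := by
    intro m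
    have h := integral_homogeneous_mul_gaussian (𝕜 := ℝ) (n := n) (2 * m)
      (fun z => ‖inner ℂ a z‖ ^ (2 * m)) (fun z r hr => by
        rw [← Complex.coe_smul, inner_smul_right, norm_mul, Complex.norm_real,
          Real.norm_of_nonneg hr.le, mul_pow]
        rfl)
    rw [← hgauss a m]
    refine h.trans ?_
    have harg : (2 * (n : ℝ) + (2 * m : ℕ)) / 2 = ((n - 1 + m : ℕ) : ℝ) + 1 := by
      rw [Nat.cast_add, Nat.cast_sub NeZero.one_le]
      push_cast
      ring
    rw [← Real.Gamma_nat_eq_factorial, harg]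
    rfl
  -- The case `m = 0` expresses `c` through the total mass of the sphere, which eliminates both
  -- constants.
  have h0 := hpolar 0
  have hk := hpolar k
  simp only [mul_zero, pow_zero, Nat.factorial_zero, Nat.cast_one, mul_one, add_zero,
    integral_const, smul_eq_mul] at h0
  rw [integral_sphereMeasure, smul_eq_mul]
  set A := (volume : Measure (Cn n)).toSphere.real univ with hA
  have hA0 : A ≠ 0 := by
    intro h
    rw [h] at h0
    simp [hc.ne'] at h0
  have hchoose : ((k + (n - 1)).choose (n - 1) : ℝ) * (k.factorial * (n - 1).factorial) =
      (n - 1 + k).factorial := by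
    rw [add_comm (n - 1) k, ← Nat.add_choose_mul_factorial_mul_factorial k (n - 1)]
    push_cast
    ring
  have hf1 : (k.factorial : ℝ) ≠ 0 := by positivity
  have hf2 : ((n - 1).factorial : ℝ) ≠ 0 := by positivity
  rw [h0, ← hchoose] at hk
  set I := ∫ ζ : Sphere n, ‖inner ℂ a (ζ : Cn n)‖ ^ (2 * k) ∂(volume : Measure (Cn n)).toSphere
  field_simp
  refine mul_left_cancel₀ (mul_ne_zero hf1 hf2) ?_
  linear_combination -2 * hk

/-! ### Partial sums of the Szegő kernel in the Hardy space -/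

/-- The partial sums of the Szegő kernel `(1 - ⟨z, a⟩) ^ (-n)`. -/
def szegoPartialSum {n : ℕ} (a : Cn n) (N : ℕ) (z : Cn n) : ℂ :=
  ∑ k ∈ Finset.range N, ((k + (n - 1)).choose (n - 1) : ℂ) * inner ℂ a z ^ k

/-- The value at `a` of the partial sums of the Szegő kernel with pole `a`, as a function of the
norm of `a`. -/
def szegoDiagonal (n N : ℕ) (r : ℝ) : ℝ :=
  ∑ k ∈ Finset.range N, ((k + (n - 1)).choose (n - 1) : ℝ) * r ^ (2 * k)

lemma continuous_szegoPartialSum {n : ℕ} (a : Cn n) (N : ℕ) :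
    Continuous (szegoPartialSum a N) := by
  unfold szegoPartialSum
  fun_prop

open scoped ComplexConjugate in
-- Orthogonality leaves only the diagonal terms of the expanded square. In each of them the moment
-- cancels one of the two binomial factors.
lemma integral_norm_szegoPartialSum_sq {n : ℕ} [NeZero n] (a : Cn n) (N : ℕ) :
    ∫ ζ : Sphere n, ‖szegoPartialSum a N ζ‖ ^ 2 ∂sphereMeasure n = szegoDiagonal n N ‖a‖ := by
  have hint : ∀ f : Sphere n → ℂ, Continuous f → Integrable f (sphereMeasure n) := fun f hf =>
    hf.integrable_of_hasCompactSupport (HasCompactSupport.of_compactSpace f)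
  have key : ((∫ ζ : Sphere n, ‖szegoPartialSum a N ζ‖ ^ 2 ∂sphereMeasure n : ℝ) : ℂ) =
      (szegoDiagonal n N ‖a‖ : ℂ) := by
    rw [← integral_complex_ofReal]
    have hexp : ∀ ζ : Sphere n, ((‖szegoPartialSum a N ζ‖ ^ 2 : ℝ) : ℂ) =
        ∑ j ∈ Finset.range N, ∑ k ∈ Finset.range N,
          (((j + (n - 1)).choose (n - 1) : ℂ) * ((k + (n - 1)).choose (n - 1) : ℂ)) *
            (inner ℂ a (ζ : Cn n) ^ j * conj (inner ℂ a (ζ : Cn n)) ^ k) := by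
      intro ζ
      rw [Complex.ofReal_pow, ← Complex.mul_conj', szegoPartialSum, map_sum,
        Finset.sum_mul_sum]
      refine Finset.sum_congr rfl fun j _ => Finset.sum_congr rfl fun k _ => ?_
      rw [map_mul, map_pow, Complex.conj_natCast]
      ring
    simp only [hexp]
    rw [integral_finsetSum _ fun j _ => hint _ (by fun_prop)]
    rw [szegoDiagonal, Complex.ofReal_sum]
    refine Finset.sum_congr rfl fun j hj => ?_
    rw [integral_finsetSum _ fun k _ => hint _ (by fun_prop), Finset.sum_eq_single j]
    · rw [integral_const_mul, ← integral_norm_inner_pow a j]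
      have h2 : ∀ ζ : Sphere n, inner ℂ a (ζ : Cn n) ^ j * conj (inner ℂ a (ζ : Cn n)) ^ j =
          ((‖inner ℂ a (ζ : Cn n)‖ ^ (2 * j) : ℝ) : ℂ) := by
        intro ζ
        rw [← mul_pow, Complex.mul_conj', ← pow_mul, Complex.ofReal_pow]
      simp only [h2]
      rw [integral_complex_ofReal]
      push_cast
      ring
    · intro k _ hkj
      rw [integral_const_mul, integral_sphereMeasure,
        integral_toSphere_inner_pow_mul_conj a hkj.symm, smul_zero, mul_zero]
    · exact fun h => (h hj).elim
  exact_mod_cast key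

lemma szegoDiagonal_mono {n N : ℕ} {r s : ℝ} (hr : 0 ≤ r) (hrs : r ≤ s) :
    szegoDiagonal n N r ≤ szegoDiagonal n N s := by
  unfold szegoDiagonal
  gcongr

/-- Dilating the variable by `r` amounts to dilating the pole by `r`, and the diagonal value grows
with the norm of the pole. -/
lemma energy_szegoPartialSum_le {n : ℕ} [NeZero n] (a : Cn n) (N : ℕ) :
    energy (fun z : Ball n => szegoPartialSum a N z) ≤
      ENNReal.ofReal (szegoDiagonal n N ‖a‖) := by
  refine iSup_le fun r => ?_
  have hdil : ∀ ζ : Sphere n, szegoPartialSum a N (dilate r ζ) =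
      szegoPartialSum ((r : ℝ) • a) N ζ := by
    intro ζ
    have h : inner ℂ a ((r : ℝ) • (ζ : Cn n)) = inner ℂ ((r : ℝ) • a) (ζ : Cn n) := by
      rw [← Complex.coe_smul, ← Complex.coe_smul, inner_smul_right, inner_smul_left,
        Complex.conj_ofReal]
    simp only [szegoPartialSum, dilate, h]
  simp only [hdil]
  have hc : Continuous fun ζ : Sphere n => ‖szegoPartialSum ((r : ℝ) • a) N ζ‖ ^ 2 :=
    (((continuous_szegoPartialSum _ N).comp continuous_subtype_val).norm).pow 2
  calc ∫⁻ ζ : Sphere n, ‖szegoPartialSum ((r : ℝ) • a) N ζ‖ₑ ^ 2 ∂sphereMeasure n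
      = ∫⁻ ζ : Sphere n, ENNReal.ofReal (‖szegoPartialSum ((r : ℝ) • a) N ζ‖ ^ 2)
          ∂sphereMeasure n := by
        simp only [ENNReal.ofReal_pow (norm_nonneg _), ofReal_norm]
    _ = ENNReal.ofReal (szegoDiagonal n N ‖(r : ℝ) • a‖) := by
        rw [← integral_norm_szegoPartialSum_sq, ofReal_integral_eq_lintegral_ofReal
          (hc.integrable_of_hasCompactSupport (HasCompactSupport.of_compactSpace _))
          (.of_forall fun ζ => by positivity)]
    _ ≤ _ := by
        refine ENNReal.ofReal_le_ofReal (szegoDiagonal_mono (norm_nonneg _) ?_)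
        rw [norm_smul, Real.norm_of_nonneg r.2.1]
        exact mul_le_of_le_one_left (norm_nonneg _) r.2.2.le

/-- The partial sums of the Szegő kernel as elements of the Hardy space. -/
def szegoPartialSumH2 {n : ℕ} [NeZero n] (a : Cn n) (N : ℕ) : H2 n :=
  ⟨fun z => szegoPartialSum a N z,
    ⟨szegoPartialSum a N, by
      unfold szegoPartialSum
      exact (Differentiable.fun_sum fun k _ => (((innerSL ℂ a).differentiable.pow k).const_mul
        _)).differentiableOn, fun _ => rfl⟩,
    (energy_szegoPartialSum_le a N).trans_lt ENNReal.ofReal_lt_top⟩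

lemma szegoDiagonal_nonneg (n N : ℕ) (r : ℝ) : 0 ≤ szegoDiagonal n N r :=
  Finset.sum_nonneg fun k _ => mul_nonneg (Nat.cast_nonneg _) ((even_two_mul k).pow_nonneg r)

lemma norm_szegoPartialSumH2_le {n : ℕ} [NeZero n] (a : Cn n) (N : ℕ) :
    ‖szegoPartialSumH2 a N‖ ≤ √(szegoDiagonal n N ‖a‖) := by
  rw [norm_def]
  exact Real.sqrt_le_sqrt (ENNReal.toReal_le_of_le_ofReal (szegoDiagonal_nonneg _ _ _)
    (energy_szegoPartialSum_le a N))

lemma szegoPartialSum_self {n : ℕ} (a : Cn n) (N : ℕ) :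
    szegoPartialSum a N a = (szegoDiagonal n N ‖a‖ : ℂ) := by
  simp only [szegoPartialSum, szegoDiagonal, inner_self_eq_norm_sq_to_K]
  push_cast
  simp only [pow_mul]
  rfl

/-- Evaluation at the centre is a contraction on the Hardy space. -/
lemma norm_apply_zero_le {n : ℕ} [NeZero n] (f : H2 n) : ‖(f : Ball n → ℂ) 0‖ ≤ ‖f‖ := by
  rw [norm_def]
  refine Real.le_sqrt_of_sq_le ?_
  rw [← ENNReal.ofReal_le_iff_le_toReal f.2.2.ne, ENNReal.ofReal_pow (norm_nonneg _), ofReal_norm]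
  -- The radius `r = 0` belongs to the supremum, and there the integrand is constant against a
  -- probability measure.
  refine le_trans (le_of_eq ?_) (le_iSup (fun r : Ico (0 : ℝ) 1 =>
    ∫⁻ ζ, ‖(f : Ball n → ℂ) (dilate r ζ)‖ₑ ^ 2 ∂(sphereMeasure n)) ⟨0, le_rfl, zero_lt_one⟩)
  have h : ∀ ζ : Sphere n, dilate ⟨0, le_rfl, zero_lt_one⟩ ζ = 0 := fun ζ =>
    Subtype.ext (zero_smul ℝ (ζ : Cn n))
  simp [h]

/-- This is the negative binomial series in `r ^ 2`. -/
lemma tendsto_szegoDiagonal (n : ℕ) [NeZero n] {r : ℝ} (hr0 : 0 ≤ r) (hr : r < 1) :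
    Filter.Tendsto (fun N => szegoDiagonal n N r) Filter.atTop (nhds (1 / (1 - r ^ 2) ^ n)) := by
  have h := (hasSum_choose_mul_geometric_of_norm_lt_one (𝕜 := ℝ) (n - 1) (r := r ^ 2) (by
    rw [Real.norm_of_nonneg (sq_nonneg r)]; nlinarith)).tendsto_sum_nat
  rw [Nat.sub_add_cancel NeZero.one_le] at h
  simpa only [szegoDiagonal, pow_mul] using h

end HardyBall

end


/-! ### The lower bounds for the operator norm -/

open HardyBall in
theorem proposition5p4 (n : ℕ) [NeZero n]
    (φ : HardyBall.Ball n → HardyBall.Ball n)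
    (T : HardyBall.H2 n →L[ℂ] HardyBall.H2 n)
    (hT : HardyBall.IsCompositionOperator φ T) :
    (1 - ‖(φ 0 : HardyBall.Cn n)‖ ^ 2) ^ (-(n : ℝ) / 2) ≤ ‖T‖ ∧
      (2 * (1 - ‖(φ 0 : HardyBall.Cn n)‖)) ^ (-(n : ℝ) / 2) <
        (1 - ‖(φ 0 : HardyBall.Cn n)‖ ^ 2) ^ (-(n : ℝ) / 2) := by
  set a : Cn n := (φ 0).1
  have ha1 : ‖a‖ < 1 := mem_ball_zero_iff.1 (φ 0).2
  have ha0 := norm_nonneg a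
  have hpos : 0 < 1 - ‖a‖ ^ 2 := by nlinarith
  have hn : (0 : ℝ) < n := Nat.cast_pos.2 (NeZero.pos n)
  -- The strict improvement: `1 - ‖a‖² = (1 - ‖a‖)(1 + ‖a‖) < 2(1 - ‖a‖)`, and the negative exponent
  -- reverses the inequality.
  refine ⟨?_, Real.rpow_lt_rpow_of_neg hpos (by nlinarith) (by linarith)⟩
  have hbound : ∀ N, szegoDiagonal n N ‖a‖ ≤ ‖T‖ ^ 2 := by
    intro N
    have hS := szegoDiagonal_nonneg n N ‖a‖
    have h1 : szegoDiagonal n N ‖a‖ ≤ ‖T‖ * √(szegoDiagonal n N ‖a‖) :=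
      calc szegoDiagonal n N ‖a‖ = ‖(T (szegoPartialSumH2 a N) : Ball n → ℂ) 0‖ := by
            rw [hT]
            change _ = ‖szegoPartialSum a N a‖
            rw [szegoPartialSum_self, Complex.norm_real, Real.norm_of_nonneg hS]
        _ ≤ ‖T (szegoPartialSumH2 a N)‖ := norm_apply_zero_le _
        _ ≤ ‖T‖ * ‖szegoPartialSumH2 a N‖ := T.le_opNorm _
        _ ≤ _ := by gcongr; exact norm_szegoPartialSumH2_le a N
    have h2 : √(szegoDiagonal n N ‖a‖) ≤ ‖T‖ := by
      -- Contradiction avoids dividing by the square root, which vanishes for the empty sum `N = 0`.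
      by_contra! hlt
      have h3 := Real.mul_self_sqrt hS
      have h4 := norm_nonneg T
      nlinarith
    exact (Real.sqrt_le_left (norm_nonneg T)).1 h2
  have hlim := le_of_tendsto' (tendsto_szegoDiagonal n ha0 ha1) hbound
  refine le_of_sq_le_sq (le_trans (le_of_eq ?_) hlim) (norm_nonneg T)
  rw [← Real.rpow_mul_natCast hpos.le, one_div, ← Real.rpow_natCast (1 - ‖a‖ ^ 2) n,
    ← Real.rpow_neg hpos.le]
  congr 1
  push_cast
  ring
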